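/- Let $W:\mathbb R\to\mathbb R$ be strictly increasing and càdlàg, with $W(x+1)-W(x)=W(1)-W(0)$ for all $x\in\mathbb R$ and $W(0)=0$ (jumps of $W$ are allowed). Let $B=(B(t))_{t\in[0,1]}$ be a $W$-Brownian bridge on $[0,1]$, i.e. a real-valued centered Gaussian process, defined on some probability space $(\Omega,\mathcal F,P)$, with covariance function $$\varrho_{W,0}(t,s)=W(t\wedge s)-\frac{W(t)W(s)}{W(1)},\qquad s,t\in[0,1].$$ For $S\subset[0,1]$ put $\mathcal F_+^{B}(S)=\bigcap_{\varepsilon>0}\sigma\big(B(s):s\in S_\varepsilon\big)$, where $S_\varepsilon=\{t\in[0,1]: d(t,S)<\varepsilon\}$ (and $\varnothing_\varepsilon=\varnothing$). Then $B$ is a Gaussian Markov random field in the sense of Künsch: $B$ is a Gaussian process and, for every relatively open set $S\subset[0,1]$, the $\sigma$-algebras $\mathcal F_+^{B}(\overline S)$ and $\mathcal F_+^{B}([0,1]\setminus S)$ are conditionally independent given $\mathcal F_+^{B}(\partial S)$, i.e. $$P(A\cap A'\mid\mathcal F_+^{B}(\partial S))=P(A\mid\mathcal F_+^{B}(\partial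 S))\,P(A'\mid\mathcal F_+^{B}(\partial S))\quad\text{a.s.}$$ for all $A\in\mathcal F_+^{B}(\overline S)$ and $A'\in\mathcal F_+^{B}([0,1]\setminus S)$. Here the closure $\overline S$ and the boundary $\partial S$ are taken in $[0,1]$. -/

import Mathlib

open MeasureTheory ProbabilityTheory

namespace WBridge

/-- The standing assumptions on the driving function `W`: it is strictly increasing and càdlàg
(left limits exist automatically for a monotone function), its increments are `1`-periodic, and
it is normalised by `W 0 = 0`. Jumps are allowed. -/
structure IsDrivingFunction (W : ℝ → ℝ) : Prop where
  strictMono : StrictMono W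
  rightCts : ∀ x, ContinuousWithinAt W (Set.Ici x) x
  periodic : ∀ x, W (x + 1) - W x = W 1 - W 0
  zero : W 0 = 0

/-- The covariance function `W (t ∧ s) - W t * W s / W 1`. -/
noncomputable def bridgeCov (W : ℝ → ℝ) (t s : ℝ) : ℝ :=
  W (min t s) - W t * W s / W 1

/-- `X` is (a version of) the `W`-Brownian bridge on `[0,1]`: a centered Gaussian process, indexed
by `[0,1]`, with covariance function `bridgeCov W`. -/
structure IsWBrownianBridge {Ω : Type*} [MeasurableSpace Ω] (W : ℝ → ℝ)
    (X : Set.Icc (0 : ℝ) 1 → Ω → ℝ) (P : Measure Ω) : Prop where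
  measurable : ∀ t, Measurable (X t)
  gaussian : IsGaussianProcess X P
  centered : ∀ t, ∫ ω, X t ω ∂P = 0
  cov_eq : ∀ t s, covariance (X t) (X s) P = bridgeCov W t s

/-- The σ-algebra `σ(X s : s ∈ S)`. -/
abbrev sigmaOn {T Ω : Type*} (X : T → Ω → ℝ) (S : Set T) : MeasurableSpace Ω :=
  ⨆ s ∈ S, MeasurableSpace.comap (X s) (borel ℝ)

/-- The germ σ-algebra `F₊(S) = ⋂_{ε > 0} σ(X s : s ∈ S_ε)`, where `S_ε` is the set of the points
at distance less than `ε` from `S`. -/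
abbrev germ {T Ω : Type*} [PseudoMetricSpace T] (X : T → Ω → ℝ) (S : Set T) : MeasurableSpace Ω :=
  ⨅ (ε : ℝ) (_ : 0 < ε), sigmaOn X (Metric.thickening ε S)

/-- The σ-algebra `m` splits `m₁` and `m₂`, that is, `m₁` and `m₂` are conditionally independent
given `m`: `P(A ∩ B | m) = P(A | m) P(B | m)` almost surely for all `A ∈ m₁` and `B ∈ m₂`.
(Mathlib's `CondIndep` says the same on standard Borel spaces only.) -/
def Splits {Ω : Type*} [MeasurableSpace Ω] (P : Measure Ω) (m m₁ m₂ : MeasurableSpace Ω) : Prop :=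
  ∀ A B : Set Ω, MeasurableSet[m₁] A → MeasurableSet[m₂] B →
    P⟦A ∩ B | m⟧ =ᵐ[P] P⟦A | m⟧ * P⟦B | m⟧

/-- `X` is a Gaussian Markov random field on the metric space `T`: it is a Gaussian process, and
for every open set `S` the germ σ-algebra of the boundary of `S` splits the germ σ-algebras of the
closure of `S` and of the complement of `S`. -/
structure IsGaussianMarkovRandomField {T Ω : Type*} [PseudoMetricSpace T] [MeasurableSpace Ω]
    (X : T → Ω → ℝ) (P : Measure Ω) : Prop where
  gaussian : IsGaussianProcess X P
  markov : ∀ S : Set T, IsOpen S →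
    Splits P (germ X (frontier S)) (germ X (closure S)) (germ X Sᶜ)

end WBridge

/-!
The bridge is Markov: for `a < b`, the difference between its value at `t ∈ [a, b]` and the linear
interpolation, in the scale `W`, of its values at `a` and `b` is uncorrelated with its values
outside `(a, b)` (`bridgeCov_eq_interpolation`). Jumps of `W` play no role in this.

Let `Γ` be a closed set containing the boundary of `S`. A point `t ∈ S` outside `Γ` lies in a gap
`(a, b)` of `Γ`, closedness provides its endpoints in `Γ` (or at `0`, `1`, where the bridge vanishes
almost surely), and the gap does not meet `Sᶜ`. So the bridge at `t` is a combination of values on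
`Γ` plus a residual uncorrelated with, hence by Gaussianity independent of, the σ-algebra
`σ(X u : u ∈ Sᶜ ∪ Γ)` (`exists_indep_sigmaOn_le_sup`). Consequently `P(B | σ(X on Γ))` is the
conditional probability of `B ∈ σ(X on Sᶜ ∪ Γ)` given `σ(X on S ∪ Γ)`
(`setIntegral_indicator_eq_condExp_of_indep`).

This is applied to the closed `1 / (n + 1)`-neighbourhoods `Γ n` of the boundary. As `[0,1]` is an
interval, a neighbourhood of `S` or of `Sᶜ` adds only points near the boundary
(`thickening_subset_union_thickening_frontier`), so that both germ σ-algebras are covered for each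
`n`. The σ-algebras over `Γ n` decrease to the germ σ-algebra of the boundary, and the identity
passes to the limit by strong convergence of orthogonal projections in `L²`
(`tendsto_setIntegral_condExp_iInf`). In the limit it gives conditional
independence (`splits_of_setIntegral_eq`).
-/

namespace WBridge

open Filter Set
open scoped Topology

/-! ### Conditional independence from an independent residual -/

theorem setIntegral_eq_mul_of_indep {Ω : Type*} {m₁ m₂ mΩ : MeasurableSpace Ω} {P : Measure Ω}
    [IsProbabilityMeasure P] (h₁ : m₁ ≤ mΩ) (h₂ : m₂ ≤ mΩ)
    (hind : Indep m₁ m₂ P) {R : Set Ω} (hR : MeasurableSet[m₁] R) {g : Ω → ℝ}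
    (hg : StronglyMeasurable[m₂] g) (hgi : Integrable g P) :
    ∫ ω in R, g ω ∂P = P.real R * ∫ ω, g ω ∂P := by
  rw [← setIntegral_condExp h₁ hgi hR,
    setIntegral_congr_ae (h₁ _ hR)
      ((condExp_indep_eq h₂ h₁ hg hind.symm).mono fun _ h _ => h)]
  simp

theorem isPiSystem_image2_inter {Ω : Type*} (m₁ m₂ : MeasurableSpace Ω) :
    IsPiSystem (image2 (· ∩ ·) {s | MeasurableSet[m₁] s} {s | MeasurableSet[m₂] s}) := by
  rintro _ ⟨R, hR, C, hC, rfl⟩ _ ⟨R', hR', C', hC', rfl⟩ -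
  exact ⟨R ∩ R', hR.inter hR', C ∩ C', hC.inter hC', by
    simp only [inter_assoc, inter_left_comm C R' C']⟩

theorem sup_eq_generateFrom_image2_inter {Ω : Type*} (m₁ m₂ : MeasurableSpace Ω) :
    m₁ ⊔ m₂ = MeasurableSpace.generateFrom
      (image2 (· ∩ ·) {s | MeasurableSet[m₁] s} {s | MeasurableSet[m₂] s}) := by
  refine le_antisymm (sup_le ?_ ?_) (MeasurableSpace.generateFrom_le ?_)
  · exact fun s hs => .basic _ ⟨s, hs, univ, .univ, inter_univ s⟩
  · exact fun s hs => .basic _ ⟨univ, .univ, s, hs, univ_inter s⟩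
  · rintro _ ⟨R, hR, C, hC, rfl⟩
    exact MeasurableSet.inter ((le_sup_left : m₁ ≤ m₁ ⊔ m₂) _ hR)
      ((le_sup_right : m₂ ≤ m₁ ⊔ m₂) _ hC)

/-- If `mR` is independent of `m₂ ⊇ m`, then conditioning `B ∈ m₂` on `mR ⊔ m` is the same as
conditioning it on `m`: the noise in `mR` carries no information on `B`. The identity is checked
on the π-system of the sets `R ∩ C`, with `R ∈ mR` and `C ∈ m`. -/
theorem setIntegral_indicator_eq_condExp_of_indep {Ω : Type*} {mR m m₂ mΩ : MeasurableSpace Ω}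
    {P : Measure Ω} [IsProbabilityMeasure P] (hR : mR ≤ mΩ) (hm : m ≤ m₂) (h₂ : m₂ ≤ mΩ)
    (hind : Indep mR m₂ P) {A B : Set Ω}
    (hA : MeasurableSet[mR ⊔ m] A) (hB : MeasurableSet[m₂] B) :
    ∫ ω in A, B.indicator (fun _ => (1 : ℝ)) ω ∂P = ∫ ω in A, (P⟦B | m⟧) ω ∂P := by
  have hsup : mR ⊔ m ≤ mΩ := sup_le hR (hm.trans h₂)
  have hi : Integrable (B.indicator fun _ => (1 : ℝ)) P :=
    (integrable_const 1).indicator (h₂ _ hB)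
  have hc : Integrable (P⟦B | m⟧) P := integrable_condExp
  have hprod : ∀ R C, MeasurableSet[mR] R → MeasurableSet[m] C →
      ∀ g : Ω → ℝ, StronglyMeasurable[m₂] g → Integrable g P →
        ∫ ω in R ∩ C, g ω ∂P = P.real R * ∫ ω in C, g ω ∂P := by
    intro R C hRm hC g hg hgi
    rw [← setIntegral_indicator (h₂ _ (hm _ hC)), ← integral_indicator (h₂ _ (hm _ hC))]
    exact setIntegral_eq_mul_of_indep hR h₂ hind hRm (hg.indicator (hm _ hC))
      (hgi.indicator (h₂ _ (hm _ hC)))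
  induction A, hA using MeasurableSpace.induction_on_inter
    (sup_eq_generateFrom_image2_inter mR m) (isPiSystem_image2_inter mR m) with
  | empty => simp
  | basic t ht =>
    obtain ⟨R, hRm, C, hC, rfl⟩ := ht
    rw [hprod R C hRm hC _ (stronglyMeasurable_const.indicator hB) hi,
      hprod R C hRm hC _ (stronglyMeasurable_condExp.mono hm) hc,
      setIntegral_condExp (hm.trans h₂) hi hC]
  | compl t ht ih =>
    rw [setIntegral_compl (hsup _ ht) hi, setIntegral_compl (hsup _ ht) hc, ih,
      integral_condExp (hm.trans h₂)]
  | iUnion f hd hf ih =>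
    exact (hasSum_integral_iUnion (fun i => hsup _ (hf i)) hd hi.integrableOn).unique
      (by simpa only [ih] using
        hasSum_integral_iUnion (fun i => hsup _ (hf i)) hd hc.integrableOn)

/-- Conditional independence in integrated form: if `m ≤ m₁`, then `m` splits `m₁` and `m₂` as soon
as `P(B | m)` is also the conditional probability of `B` given `m₁`. Unlike the product formula,
the hypothesis is linear in `P(B | m)`, so it passes to weak limits. -/
theorem splits_of_setIntegral_eq {Ω : Type*} {m m₁ m₂ mΩ : MeasurableSpace Ω}
    {P : Measure Ω} [IsProbabilityMeasure P] (hm : m ≤ m₁)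
    (h₁ : m₁ ≤ mΩ) (h₂ : m₂ ≤ mΩ)
    (h : ∀ A B, MeasurableSet[m₁] A → MeasurableSet[m₂] B →
      ∫ ω in A, B.indicator (fun _ => (1 : ℝ)) ω ∂P = ∫ ω in A, (P⟦B | m⟧) ω ∂P) :
    Splits P m m₁ m₂ := by
  intro A B hA hB
  have hi : ∀ C, MeasurableSet[mΩ] C → Integrable (C.indicator fun _ => (1 : ℝ)) P :=
    fun C hC => (integrable_const 1).indicator hC
  have hinter : (A ∩ B).indicator (fun _ => (1 : ℝ)) =
      A.indicator (fun _ => (1 : ℝ)) * B.indicator (fun _ => (1 : ℝ)) := by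
    ext ω
    by_cases h₁ : ω ∈ A <;> by_cases h₂ : ω ∈ B <;> simp [h₁, h₂]
  have hAB : Integrable (A.indicator (fun _ => (1 : ℝ)) * B.indicator (fun _ => (1 : ℝ))) P :=
    hinter ▸ hi _ ((h₁ _ hA).inter (h₂ _ hB))
  have hB₁ : P⟦B | m₁⟧ =ᵐ[P] P⟦B | m⟧ :=
    (ae_eq_condExp_of_forall_setIntegral_eq h₁ (hi B (h₂ _ hB))
      (fun s _ _ => integrable_condExp.integrableOn) (fun s hs _ => (h s B hs hB).symm)
      (stronglyMeasurable_condExp.mono hm).aestronglyMeasurable).symm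
  have hint : Integrable (A.indicator (fun _ => (1 : ℝ)) * P⟦B | m⟧) P := by
    have : A.indicator (fun _ => (1 : ℝ)) * P⟦B | m⟧ = A.indicator (P⟦B | m⟧) := by
      ext ω; by_cases hω : ω ∈ A <;> simp [hω]
    exact this ▸ integrable_condExp.indicator (h₁ _ hA)
  calc P⟦A ∩ B | m⟧ = P[A.indicator (fun _ => (1 : ℝ)) * B.indicator (fun _ => (1 : ℝ)) | m] := by
        rw [hinter]
    _ =ᵐ[P] P[P[A.indicator (fun _ => (1 : ℝ)) * B.indicator (fun _ => (1 : ℝ)) | m₁] | m] :=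
        (condExp_condExp_of_le hm h₁).symm
    _ =ᵐ[P] P[A.indicator (fun _ => (1 : ℝ)) * P⟦B | m⟧ | m] := by
        refine condExp_congr_ae ((condExp_mul_of_stronglyMeasurable_left
          (stronglyMeasurable_const.indicator hA) hAB (hi B (h₂ _ hB))).trans ?_)
        filter_upwards [hB₁] with ω hω
        simp [hω]
    _ =ᵐ[P] P⟦A | m⟧ * P⟦B | m⟧ :=
        condExp_mul_of_stronglyMeasurable_right stronglyMeasurable_condExp hint
          (hi A (h₁ _ hA))

/-! ### Conditional expectations along a decreasing sequence of σ-algebras -/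

/-- For a decreasing sequence of σ-algebras, being almost everywhere equal to a `G n`-measurable
function for each `n` implies it for the intersection: the upper limit of the versions does not
depend on finitely many of them, so it is measurable for every `G n`. -/
theorem aestronglyMeasurable_iInf_of_antitone {Ω : Type*} {mΩ : MeasurableSpace Ω}
    {P : Measure Ω} {G : ℕ → MeasurableSpace Ω} (hG : Antitone G) {f : Ω → ℝ}
    (hf : ∀ n, AEStronglyMeasurable[G n] f P) : AEStronglyMeasurable[⨅ n, G n] f P := by
  choose g hg hfg using hf
  refine ⟨fun ω => limsup (fun n => g n ω) atTop, ?_, ?_⟩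
  · suffices h : Measurable[⨅ n, G n] fun ω => limsup (fun n => g n ω) atTop from
      h.stronglyMeasurable
    intro s hs
    refine MeasurableSpace.measurableSet_iInf.2 fun N => ?_
    have : Measurable[G N] fun ω => limsup (fun n => g (n + N) ω) atTop :=
      Measurable.limsup (mδ := G N) fun n =>
        (hg (n + N)).measurable.mono (hG (Nat.le_add_left N n)) le_rfl
    simp only [fun ω => Filter.limsup_nat_add (fun n => g n ω) N] at this
    exact this hs
  · filter_upwards [ae_all_iff.2 hfg] with ω hω
    simp [← hω]

theorem iInf_lpMeas_of_antitone {Ω : Type*} {mΩ : MeasurableSpace Ω}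
    {P : Measure Ω} {G : ℕ → MeasurableSpace Ω} (hG : Antitone G) :
    ⨅ n, lpMeas ℝ ℝ (G n) 2 P = lpMeas ℝ ℝ (⨅ n, G n) 2 P := by
  ext f
  simp only [Submodule.mem_iInf, mem_lpMeas_iff_aestronglyMeasurable]
  exact ⟨aestronglyMeasurable_iInf_of_antitone hG, fun h n => h.mono (iInf_le G n)⟩

/-- The orthogonal projections onto a decreasing sequence of closed subspaces converge strongly to
the projection onto the intersection. -/
theorem tendsto_starProjection_iInf {E : Type*} [NormedAddCommGroup E] [InnerProductSpace ℝ E]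
    [CompleteSpace E] (K : ℕ → Submodule ℝ E) [∀ n, (K n).HasOrthogonalProjection]
    [(⨅ n, K n).HasOrthogonalProjection] (hK : Antitone K) (x : E) :
    Tendsto (fun n => (K n).starProjection x) atTop (𝓝 ((⨅ n, K n).starProjection x)) := by
  have hmono : Monotone fun n => (K n)ᗮ := fun i j h => Submodule.orthogonal_le (hK h)
  have hcl : (⨆ n, (K n)ᗮ).topologicalClosure = (⨅ n, K n)ᗮ := by
    rw [← Submodule.orthogonal_orthogonal_eq_closure, ← Submodule.iInf_orthogonal]
    simp only [Submodule.orthogonal_orthogonal]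
  have key := (Submodule.starProjection_tendsto_closure_iSup _ hmono x).const_sub x
  simp only [hcl, Submodule.starProjection_orthogonal_val, sub_sub_cancel] at key
  exact key

/-- A weak form of the backward martingale convergence theorem, for square-integrable functions. -/
theorem tendsto_setIntegral_condExp_iInf {Ω : Type*} {mΩ : MeasurableSpace Ω}
    {P : Measure Ω} [IsFiniteMeasure P] {G : ℕ → MeasurableSpace Ω} (hG : Antitone G)
    (hle : ∀ n, G n ≤ mΩ) {f : Ω → ℝ} (hf : MemLp f 2 P) {A : Set Ω} (hA : MeasurableSet A) :
    Tendsto (fun n => ∫ ω in A, (P[f | G n]) ω ∂P) atTop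
      (𝓝 (∫ ω in A, (P[f | ⨅ n, G n]) ω ∂P)) := by
  have hle' : ⨅ n, G n ≤ mΩ := (iInf_le G 0).trans (hle 0)
  have := fun n => Fact.mk (hle n)
  have := Fact.mk hle'
  have hK : Antitone fun n => lpMeas ℝ ℝ (G n) 2 P := fun i j h f hf => by
    rw [mem_lpMeas_iff_aestronglyMeasurable] at hf ⊢
    exact hf.mono (hG h)
  have hinst : (⨅ n, lpMeas ℝ ℝ (G n) 2 P).HasOrthogonalProjection := by
    rw [iInf_lpMeas_of_antitone hG]; infer_instance
  -- In `L²`, conditional expectation is the orthogonal projection onto `lpMeas`.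
  have hlim := tendsto_starProjection_iInf _ hK hf.toLp
  simp only [iInf_lpMeas_of_antitone hG] at hlim
  have hset : ∀ m : MeasurableSpace Ω, ∀ hm : m ≤ mΩ,
      ∫ ω in A, (P[f | m]) ω ∂P = ∫ ω in A, (condExpL2 ℝ ℝ hm hf.toLp : Ω → ℝ) ω ∂P :=
    fun m hm => setIntegral_congr_ae hA
      ((hf.condExpL2_ae_eq_condExp (𝕜 := ℝ) hm).mono fun _ h _ => h.symm)
  have hinner : ∀ m : MeasurableSpace Ω, ∀ hm : m ≤ mΩ, ∫ ω in A, (P[f | m]) ω ∂P =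
      inner ℝ (indicatorConstLp 2 hA (measure_ne_top P A) (1 : ℝ))
        (condExpL2 ℝ ℝ hm hf.toLp : Lp ℝ 2 P) := fun m hm => by
    rw [hset m hm, L2.inner_indicatorConstLp_one hA (measure_ne_top P A)]
  simp only [hinner _ (hle _), hinner _ hle']
  exact tendsto_const_nhds.inner hlim

/-! ### The covariance of the bridge and the geometry of the interval -/

/-- If exactly one of `x`, `y` is in `S`, then some point between them is in `frontier S`. -/
theorem exists_mem_frontier_mem_uIcc {α : Type*} [ConditionallyCompleteLinearOrder α]
    [TopologicalSpace α] [OrderTopology α] [DenselyOrdered α] {S : Set α} {x y : α}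
    (h : ¬(x ∈ S ↔ y ∈ S)) : ∃ z ∈ frontier S, z ∈ uIcc x y := by
  by_contra! hno
  have hcover : uIcc x y ⊆ interior S ∪ (closure S)ᶜ := fun z hz => by
    by_contra hz'
    simp only [mem_union, mem_compl_iff, not_or, not_not] at hz'
    exact hno z ⟨hz'.2, hz'.1⟩ hz
  rcases isPreconnected_uIcc.subset_or_subset isOpen_interior isClosed_closure.isOpen_compl
    (disjoint_compl_right.mono_left (interior_subset.trans subset_closure)) hcover with hs | hs
  · exact h (iff_of_true (interior_subset (hs left_mem_uIcc)) (interior_subset (hs right_mem_uIcc)))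
  · exact h (iff_of_false (fun hx => hs left_mem_uIcc (subset_closure hx))
      fun hy => hs right_mem_uIcc (subset_closure hy))

open Metric in
theorem thickening_subset_union_thickening_frontier (S : Set (Icc (0 : ℝ) 1)) (ε : ℝ) :
    thickening ε S ⊆ S ∪ thickening ε (frontier S) := by
  intro x hx
  by_cases hxS : x ∈ S
  · exact .inl hxS
  obtain ⟨y, hy, hd⟩ := mem_thickening_iff.1 hx
  obtain ⟨z, hz, hzxy⟩ := exists_mem_frontier_mem_uIcc (S := S) (x := x) (y := y)
    (by tauto)
  refine .inr (mem_thickening_iff.2 ⟨z, hz, lt_of_le_of_lt ?_ hd⟩)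
  refine Real.dist_left_le_of_mem_uIcc (x := (x : ℝ)) (y := z) (z := y) ?_
  rcases le_total x y with h | h
  · rw [uIcc_of_le h] at hzxy
    exact Icc_subset_uIcc ⟨hzxy.1, hzxy.2⟩
  · rw [uIcc_of_ge h] at hzxy
    exact Icc_subset_uIcc' ⟨hzxy.1, hzxy.2⟩

theorem bridgeCov_zero_left {W : ℝ → ℝ} (hW : IsDrivingFunction W) {u : ℝ} (hu : 0 ≤ u) :
    bridgeCov W 0 u = 0 := by
  simp [bridgeCov, min_eq_left hu, hW.zero]

theorem bridgeCov_one_left {W : ℝ → ℝ} (hW : IsDrivingFunction W) {u : ℝ} (hu : u ≤ 1) :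
    bridgeCov W 1 u = 0 := by
  have h1 : W 1 ≠ 0 := (hW.zero ▸ hW.strictMono zero_lt_one : 0 < W 1).ne'
  simp [bridgeCov, min_eq_right hu, mul_div_cancel_left₀ _ h1]

/-- Against a point `u` outside `(a, b)`, the value of the bridge at `t ∈ [a, b]` has the same
covariance as its linear interpolation, in the scale `W`, between the values at `a` and `b`. -/
theorem bridgeCov_eq_interpolation {W : ℝ → ℝ} (hW : IsDrivingFunction W) {a t b u : ℝ}
    (hat : a ≤ t) (htb : t ≤ b) (hab : a < b) (hu : u ≤ a ∨ b ≤ u) :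
    bridgeCov W t u = (W b - W t) / (W b - W a) * bridgeCov W a u +
      (W t - W a) / (W b - W a) * bridgeCov W b u := by
  have hd : W b - W a ≠ 0 := (sub_pos.2 (hW.strictMono hab)).ne'
  have h1 : W 1 ≠ 0 := (hW.zero ▸ hW.strictMono zero_lt_one : 0 < W 1).ne'
  unfold bridgeCov
  rcases hu with hu | hu
  · rw [min_eq_right hu, min_eq_right (hu.trans hat), min_eq_right (hu.trans hab.le)]
    field_simp
    ring
  · rw [min_eq_left hu, min_eq_left (htb.trans hu), min_eq_left (hab.le.trans hu)]
    field_simp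
    ring

/-- For a closed `Γ ⊇ frontier S` and `t ∈ S ∪ Γ`, some combination of at most two values of the
bridge on `Γ` has the same covariances with the values on `Sᶜ ∪ Γ` as the value at `t`. For
`t ∉ Γ` the two points are the nearest points of `Γ` on either side of `t`: all of `Sᶜ ∪ Γ` lies
outside the interval between them. If there is no point of `Γ` on one side, the endpoint of `[0,1]`
serves, with coefficient `0` since the bridge vanishes there. -/
theorem exists_bridgeCov_eq_of_isClosed {W : ℝ → ℝ} (hW : IsDrivingFunction W)
    {S Γ : Set (Icc (0 : ℝ) 1)} (hΓ : IsClosed Γ) (hS : frontier S ⊆ Γ)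
    {t : Icc (0 : ℝ) 1} (ht : t ∈ S ∪ Γ) :
    ∃ (a b : Icc (0 : ℝ) 1) (α β : ℝ), (α = 0 ∨ a ∈ Γ) ∧ (β = 0 ∨ b ∈ Γ) ∧
      ∀ u ∈ Sᶜ ∪ Γ, bridgeCov W t u = α * bridgeCov W a u + β * bridgeCov W b u := by
  by_cases htΓ : t ∈ Γ
  · exact ⟨t, t, 1, 0, .inr htΓ, .inl rfl, fun u _ => by ring⟩
  have htS : t ∈ S := ht.resolve_right htΓ
  by_cases ht0 : t = 0
  · exact ⟨t, t, 0, 0, .inl rfl, .inl rfl, fun u _ => by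
      simpa [ht0] using bridgeCov_zero_left hW u.2.1⟩
  by_cases ht1 : t = 1
  · exact ⟨t, t, 0, 0, .inl rfl, .inl rfl, fun u _ => by
      simpa [ht1] using bridgeCov_one_left hW u.2.2⟩
  obtain ⟨a, hat, ha, hamax⟩ : ∃ a < t, (a = 0 ∨ a ∈ Γ) ∧ ∀ x ∈ Γ, x ≤ t → x ≤ a := by
    rcases (Γ ∩ Iic t).eq_empty_or_nonempty with h | h
    · exact ⟨0, lt_of_le_of_ne t.2.1 (Ne.symm ht0), .inl rfl,
        fun x hx hxt => (h.le ⟨hx, hxt⟩ : x ∈ (∅ : Set _)).elim⟩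
    · obtain ⟨a, ⟨haΓ, hat⟩, hmax⟩ := (hΓ.inter isClosed_Iic).isCompact.exists_isGreatest h
      exact ⟨a, lt_of_le_of_ne hat fun h => htΓ (h ▸ haΓ), .inr haΓ,
        fun x hx hxt => hmax ⟨hx, hxt⟩⟩
  obtain ⟨b, htb, hb, hbmin⟩ : ∃ b > t, (b = 1 ∨ b ∈ Γ) ∧ ∀ x ∈ Γ, t ≤ x → b ≤ x := by
    rcases (Γ ∩ Ici t).eq_empty_or_nonempty with h | h
    · exact ⟨1, lt_of_le_of_ne t.2.2 ht1, .inl rfl,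
        fun x hx hxt => (h.le ⟨hx, hxt⟩ : x ∈ (∅ : Set _)).elim⟩
    · obtain ⟨b, ⟨hbΓ, htb⟩, hmin⟩ := (hΓ.inter isClosed_Ici).isCompact.exists_isLeast h
      exact ⟨b, lt_of_le_of_ne htb fun h => htΓ (h ▸ hbΓ), .inr hbΓ,
        fun x hx hxt => hmin ⟨hx, hxt⟩⟩
  -- No point of `Sᶜ` is in `(a, b)`: on its way to `t ∈ S` it would meet `frontier S ⊆ Γ`.
  have hu : ∀ u ∈ Sᶜ ∪ Γ, u ≤ a ∨ b ≤ u := by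
    rintro u (huS | huΓ)
    · obtain ⟨z, hz, hzut⟩ := exists_mem_frontier_mem_uIcc (S := S) (x := u) (y := t)
        (fun h => huS (h.2 htS))
      rcases le_total u t with h | h
      · rw [uIcc_of_le h] at hzut
        exact .inl (hzut.1.trans (hamax z (hS hz) hzut.2))
      · rw [uIcc_of_ge h] at hzut
        exact .inr ((hbmin z (hS hz) hzut.1).trans hzut.2)
    · exact (le_total u t).imp (hamax u huΓ) (hbmin u huΓ)
  classical
  refine ⟨a, b, if a ∈ Γ then (W b - W t) / (W b - W a) else 0,
    if b ∈ Γ then (W t - W a) / (W b - W a) else 0, ?_, ?_, fun u hu' => ?_⟩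
  · by_cases h : a ∈ Γ <;> simp [h]
  · by_cases h : b ∈ Γ <;> simp [h]
  rw [bridgeCov_eq_interpolation hW (a := a) (b := b) hat.le htb.le (hat.trans htb) (hu u hu')]
  have ha0 : a ∉ Γ → bridgeCov W a u = 0 := fun h => by
    simpa [ha.resolve_right h] using bridgeCov_zero_left hW u.2.1
  have hb0 : b ∉ Γ → bridgeCov W b u = 0 := fun h => by
    simpa [hb.resolve_right h] using bridgeCov_one_left hW u.2.2
  by_cases h : a ∈ Γ <;> by_cases h' : b ∈ Γ <;> simp [h, h', ha0, hb0]

/-! ### The σ-algebras generated by a process -/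

theorem sigmaOn_mono {T Ω : Type*} (X : T → Ω → ℝ) {S S' : Set T} (h : S ⊆ S') :
    sigmaOn X S ≤ sigmaOn X S' :=
  biSup_mono h

theorem comap_le_sigmaOn {T Ω : Type*} (X : T → Ω → ℝ) {S : Set T} {t : T} (h : t ∈ S) :
    MeasurableSpace.comap (X t) (borel ℝ) ≤ sigmaOn X S :=
  le_iSup₂_of_le t h le_rfl

theorem measurable_sigmaOn {T Ω : Type*} (X : T → Ω → ℝ) {S : Set T} {t : T} (h : t ∈ S) :
    Measurable[sigmaOn X S] (X t) := by
  rw [measurable_iff_comap_le, BorelSpace.measurable_eq (α := ℝ)]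
  exact comap_le_sigmaOn X h

theorem sigmaOn_le {T Ω : Type*} {mΩ : MeasurableSpace Ω} {X : T → Ω → ℝ}
    (hX : ∀ t, Measurable (X t)) (S : Set T) : sigmaOn X S ≤ mΩ :=
  iSup₂_le fun t _ => by
    rw [← BorelSpace.measurable_eq (α := ℝ)]
    exact (hX t).comap_le

theorem comap_restrict_eq_sigmaOn {T Ω : Type*} (X : T → Ω → ℝ) (S : Set T) :
    MeasurableSpace.comap (fun ω (s : S) => X s ω) MeasurableSpace.pi = sigmaOn X S := by
  simp only [MeasurableSpace.pi, MeasurableSpace.comap_iSup, MeasurableSpace.comap_comp,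
    Function.comp_def, sigmaOn, iSup_subtype, BorelSpace.measurable_eq (α := ℝ)]

theorem germ_le_sigmaOn {T Ω : Type*} [PseudoMetricSpace T] (X : T → Ω → ℝ) {S S' : Set T} {ε : ℝ}
    (hε : 0 < ε) (h : Metric.thickening ε S ⊆ S') : germ X S ≤ sigmaOn X S' :=
  (iInf₂_le ε hε).trans (sigmaOn_mono X h)

theorem germ_mono {T Ω : Type*} [PseudoMetricSpace T] (X : T → Ω → ℝ) {S S' : Set T} (h : S ⊆ S') :
    germ X S ≤ germ X S' :=
  iInf₂_mono fun ε _ => sigmaOn_mono X (Metric.thickening_subset_of_subset ε h)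

/-- The open neighbourhoods defining the germ σ-algebra interleave with a sequence of closed ones. -/
theorem germ_eq_iInf_sigmaOn_cthickening {T Ω : Type*} [PseudoMetricSpace T] (X : T → Ω → ℝ)
    (S : Set T) :
    germ X S = ⨅ n : ℕ, sigmaOn X (Metric.cthickening (1 / ((n : ℝ) + 1)) S) := by
  refine le_antisymm (le_iInf fun n => germ_le_sigmaOn X Nat.one_div_pos_of_nat
    (Metric.thickening_subset_cthickening _ _)) (le_iInf₂ fun ε hε => ?_)
  obtain ⟨n, hn⟩ := exists_nat_one_div_lt hε
  exact (iInf_le _ n).trans (sigmaOn_mono X (Metric.cthickening_subset_thickening' hε hn S))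

/-! ### The residuals of the bridge -/

/-- The residuals of the values of the bridge on `S ∪ Γ`, after subtraction of combinations of
values on `Γ`, generate a σ-algebra independent of the values on `Sᶜ ∪ Γ`: the two families are jointly
Gaussian and uncorrelated. Together with the values on `Γ` they recover the values on `S ∪ Γ`. -/
theorem exists_indep_sigmaOn_le_sup {Ω : Type*} {mΩ : MeasurableSpace Ω} {P : Measure Ω}
    [IsProbabilityMeasure P] {W : ℝ → ℝ} (hW : IsDrivingFunction W) {X : Icc (0 : ℝ) 1 → Ω → ℝ}
    (hX : IsWBrownianBridge W X P) {S Γ : Set (Icc (0 : ℝ) 1)} (hΓ : IsClosed Γ)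
    (hS : frontier S ⊆ Γ) :
    ∃ mR : MeasurableSpace Ω, mR ≤ mΩ ∧ Indep mR (sigmaOn X (Sᶜ ∪ Γ)) P ∧
      sigmaOn X (S ∪ Γ) ≤ mR ⊔ sigmaOn X Γ := by
  choose a b α β hα hβ hcov using fun t : ↥(S ∪ Γ) =>
    exists_bridgeCov_eq_of_isClosed hW hΓ hS t.2
  let ρ : ↥(S ∪ Γ) → Ω → ℝ := fun t => X t - (α t • X (a t) + β t • X (b t))
  have hρm : ∀ t, Measurable (ρ t) := fun t =>
    (hX.measurable t).sub (((hX.measurable (a t)).const_smul (α t)).add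
      ((hX.measurable (b t)).const_smul (β t)))
  have hL2 : ∀ t, MemLp (X t) 2 P := fun t => (hX.gaussian.hasGaussianLaw_eval t).memLp_two
  have hgauss : IsGaussianProcess
      (Sum.elim ρ fun (u : ↥(Sᶜ ∪ Γ)) => X u) P := by
    classical
    refine hX.gaussian.of_isGaussianProcess fun s => ?_
    rcases s with t | u
    · refine ⟨{(t : Icc (0 : ℝ) 1), a t, b t},
        .proj ⟨(t : Icc (0 : ℝ) 1), by simp⟩ -
          (α t • .proj ⟨a t, by simp⟩ + β t • .proj ⟨b t, by simp⟩), fun ω => ?_⟩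
      simp [ρ]
    · exact ⟨{(u : Icc (0 : ℝ) 1)}, .proj ⟨u, by simp⟩, fun ω => by simp⟩
  have hind : IndepFun (fun ω t => ρ t ω) (fun ω (u : ↥(Sᶜ ∪ Γ)) => X u ω) P := by
    refine hgauss.indepFun_of_covariance_eq_zero (fun t => (hρm t).aemeasurable)
      (fun u => (hX.measurable u).aemeasurable) fun t u => ?_
    have ha := (hL2 (a t)).const_smul (α t)
    have hb := (hL2 (b t)).const_smul (β t)
    rw [covariance_sub_left (hL2 t) (ha.add hb) (hL2 u), covariance_add_left ha hb (hL2 u),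
      covariance_smul_left, covariance_smul_left, hX.cov_eq, hX.cov_eq, hX.cov_eq,
      hcov t u u.2, sub_self]
  refine ⟨MeasurableSpace.comap (fun ω t => ρ t ω) MeasurableSpace.pi,
    (measurable_pi_lambda _ hρm).comap_le, ?_, ?_⟩
  · rw [← comap_restrict_eq_sigmaOn]
    exact hind
  · set mR := MeasurableSpace.comap (fun ω t => ρ t ω) MeasurableSpace.pi
    have hsmul : ∀ (c : ℝ) (s : Icc (0 : ℝ) 1), (c = 0 ∨ s ∈ Γ) →
        Measurable[mR ⊔ sigmaOn X Γ] (c • X s) := by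
      rintro c s (rfl | hs)
      · rw [zero_smul]
        exact measurable_const
      · exact ((measurable_sigmaOn X hs).mono le_sup_right le_rfl).const_smul c
    refine iSup₂_le fun t ht => ?_
    have hρ : Measurable[mR ⊔ sigmaOn X Γ] (ρ ⟨t, ht⟩) :=
      Measurable.mono (ma := mR) ((measurable_pi_apply (⟨t, ht⟩ : ↥(S ∪ Γ))).comp
        (comap_measurable fun ω t => ρ t ω)) le_sup_left le_rfl
    have hXt : Measurable[mR ⊔ sigmaOn X Γ] (X t) := by
      have := hρ.add ((hsmul _ _ (hα ⟨t, ht⟩)).add (hsmul _ _ (hβ ⟨t, ht⟩)))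
      simpa [ρ] using this
    rw [← BorelSpace.measurable_eq (α := ℝ)]
    exact hXt.comap_le

end WBridge

theorem proposition7p3 {Ω : Type*} [MeasurableSpace Ω] (P : Measure Ω) [IsProbabilityMeasure P]
    (W : ℝ → ℝ) (hW : WBridge.IsDrivingFunction W)
    (X : Set.Icc (0 : ℝ) 1 → Ω → ℝ) (hX : WBridge.IsWBrownianBridge W X P) :
    WBridge.IsGaussianMarkovRandomField X P := by
  refine ⟨hX.gaussian, fun S _ => ?_⟩
  -- Closed neighbourhoods, so that a point outside `Γ n` has nearest points in `Γ n`.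
  let Γ : ℕ → Set (Set.Icc (0 : ℝ) 1) := fun n =>
    Metric.cthickening (1 / ((n : ℝ) + 1)) (frontier S)
  have hle := WBridge.sigmaOn_le hX.measurable
  have hanti : Antitone fun n => WBridge.sigmaOn X (Γ n) := fun i j h =>
    WBridge.sigmaOn_mono X (Metric.cthickening_mono (Nat.one_div_le_one_div h) _)
  have hgerm_le : ∀ S', WBridge.germ X S' ≤ (inferInstance : MeasurableSpace Ω) := fun S' =>
    (WBridge.germ_le_sigmaOn X one_pos subset_rfl).trans (hle _)
  have hthick : ∀ (n : ℕ) S', frontier S' = frontier S →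
      Metric.thickening (1 / ((n : ℝ) + 1)) S' ⊆ S' ∪ Γ n := fun n S' h =>
    (WBridge.thickening_subset_union_thickening_frontier S' _).trans
      (Set.union_subset_union_right _ (h ▸ Metric.thickening_subset_cthickening _ _))
  refine WBridge.splits_of_setIntegral_eq (WBridge.germ_mono X frontier_subset_closure)
    (hgerm_le _) (hgerm_le _) fun A B hA hB => ?_
  have hn : ∀ n, ∫ ω in A, B.indicator (fun _ => (1 : ℝ)) ω ∂P =
      ∫ ω in A, (P⟦B | WBridge.sigmaOn X (Γ n)⟧) ω ∂P := by
    intro n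
    obtain ⟨mR, hmR, hind, hsup⟩ := WBridge.exists_indep_sigmaOn_le_sup hW hX (S := S) (Γ := Γ n)
      Metric.isClosed_cthickening (Metric.self_subset_cthickening _)
    refine WBridge.setIntegral_indicator_eq_condExp_of_indep hmR
      (WBridge.sigmaOn_mono X Set.subset_union_right) (hle _) hind
      (hsup _ (WBridge.germ_le_sigmaOn X (Nat.one_div_pos_of_nat (n := n)) ?_ _ hA))
      (WBridge.germ_le_sigmaOn X Nat.one_div_pos_of_nat (hthick n _ (frontier_compl S)) _ hB)
    rw [Metric.thickening_closure]
    exact hthick n S rfl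
  rw [WBridge.germ_eq_iInf_sigmaOn_cthickening]
  exact tendsto_nhds_unique (Filter.Tendsto.congr hn tendsto_const_nhds)
    (WBridge.tendsto_setIntegral_condExp_iInf hanti (fun n => hle (Γ n))
      ((memLp_const 1).indicator (hgerm_le _ _ hB)) (hgerm_le _ _ hA))
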